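/- Let $\mathcal U,\mathcal V,\mathcal X$ be finite alphabets of sizes $d_U,d_V,d_X$, let $B$ be a quantum system of finite dimension $d_B$, and let $$\rho^{UVXB}=\sum_{u,v,x}p(u,v,x)\,|u\rangle\langle u|\otimes|v\rangle\langle v|\otimes|x\rangle\langle x|\otimes\rho^B_{u,v,x}$$ be a cq-state, with $p$ a probability distribution and the $\rho^B_{u,v,x}$ density matrices on $B$. Let $\rho^B$ be its reduced state on $B$, and let $\rho^B_u$, $\rho^B_v$, $\rho^B_{v,x}$ be the conditional states of $B$ given $U=u$, given $V=v$, and given $(V,X)=(v,x)$; that is, density matrices with $p(u)\rho^B_u=\sum_{v,x}p(u,v,x)\rho^B_{u,v,x}$, $p(v)\rho^B_v=\sum_{u,x}p(u,v,x)\rho^B_{u,v,x}$ and $p(v,x)\rho^B_{v,x}=\sum_{u}p(u,v,x)\rho^B_{u,v,x}$ (arbitrary density matrices for letters of probability zero). For a Hermitian operator $H=\sum_i h_iH_i$ with distinct eigenvalues $h_i$ and orthogonal projections $H_i$ onto the corresponding eigenspaces, the pinching map of $H$ is $\mathcal E_H(Y)=\sum_iH_iYH_i$. For $n\in\mathbb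 N$ and sequences $u^n\in\mathcal U^n$, $v^n\in\mathcal V^n$, $x^n\in\mathcal X^n$ put $$\rho^{B^n}_{u^n}=\bigotimes_{i=1}^n\rho^B_{u_i},\qquad \rho^{B^n}_{v^n}=\bigotimes_{i=1}^n\rho^B_{v_i},\qquad \rho^{B^n}_{v^n,x^n}=\bigotimes_{i=1}^n\rho^B_{v_i,x_i}.$$ Let $\mathcal E^{B^n}$ be the pinching map of $(\rho^B)^{\otimes n}$, and let $\mathcal E^{B^n}_{1|u^n}$ be the pinching map of $\mathcal E^{B^n}(\rho^{B^n}_{u^n})$. Let $\nu$ be the number of distinct eigenvalues of $(\rho^B)^{\otimes n}$, and let $\nu_1,\nu_2,\nu_3$ be the maximal numbers of distinct eigenvalues of $\mathcal E^{B^n}(\rho^{B^n}_{u^n})$ over all $u^n$, of $\mathcal E^{B^n}_{1|u^n}(\rho^{B^n}_{v^n})$ over all $u^n,v^n$, and of $\mathcal E^{B^n}_{1|u^n}(\rho^{B^n}_{v^n,x^n})$ over all $u^n,v^n,x^n$, respectively. Then these numbers are polynomially bounded in $n$; more precisely, for every $n$, $$\nu\le(n+1)^{d_B-1},\qquad \nu_1\le(n+1)^{d_U(d_B+2)(d_B-1)/2},$$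 $$\nu_2\le(n+1)^{d_Vd_U(d_B+2)(d_B-1)/2},\qquad \nu_3\le(n+1)^{d_Xd_Vd_U(d_B+2)(d_B-1)/2}.$$ -/

import Mathlib

noncomputable section

namespace Pinching

open scoped ComplexOrder

/-- A density matrix (quantum state): positive semidefinite with unit trace. -/
structure IsDensity {ι : Type*} [Fintype ι] (M : Matrix ι ι ℂ) : Prop where
  posSemidef : M.PosSemidef
  trace_eq_one : M.trace = 1

/-- A cq-state on `Z B`: a density matrix which is block diagonal in the classical register `Z`,
i.e. of the form `∑ z, p z • |z⟩⟨z| ⊗ ρ_z`. -/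
structure IsCQState {Z B : Type*} [Fintype Z] [Fintype B]
    (ρ : Matrix (Z × B) (Z × B) ℂ) : Prop where
  isDensity : IsDensity ρ
  classical : ∀ z z' : Z, z ≠ z' → ∀ a b : B, ρ (z, a) (z', b) = 0

/-- The reduced state `ρ^B` (partial trace over the classical register). -/
def reducedState {Z B : Type*} [Fintype Z] (ρ : Matrix (Z × B) (Z × B) ℂ) : Matrix B B ℂ :=
  Matrix.of fun a b => ∑ z, ρ (z, a) (z, b)

/-- For a function `f` of the classical register, the unnormalised state of `B` on the event
`f z = w`, namely `∑_{z : f z = w} p z • ρ_z`. Its trace is the probability of the event. -/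
def subState {Z W B : Type*} [Fintype Z] [DecidableEq W] (f : Z → W)
    (ρ : Matrix (Z × B) (Z × B) ℂ) (w : W) : Matrix B B ℂ :=
  Matrix.of fun a b => ∑ z with f z = w, ρ (z, a) (z, b)

/-- `σ w` is the conditional state `ρ_w^B` of the cq-state `ρ` given `f z = w`: a density matrix
with `P(f = w) • σ w = ∑_{z : f z = w} p z • ρ_z`. This determines `σ w` if `P(f = w) > 0`; for
letters of probability zero any density matrix is allowed. -/
structure IsConditionalState {Z W B : Type*} [Fintype Z] [Fintype B] [DecidableEq W] (f : Z → W)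
    (ρ : Matrix (Z × B) (Z × B) ℂ) (σ : W → Matrix B B ℂ) : Prop where
  isDensity : ∀ w, IsDensity (σ w)
  trace_smul : ∀ w, (subState f ρ w).trace • σ w = subState f ρ w

/-- The tensor product `M_1 ⊗ ⋯ ⊗ M_n` of matrices on `B`, as a matrix on `B^n`. -/
def tensor {B : Type*} {n : ℕ} (M : Fin n → Matrix B B ℂ) :
    Matrix (Fin n → B) (Fin n → B) ℂ :=
  Matrix.of fun a b => ∏ i, M i (a i) (b i)

/-- The number of distinct eigenvalues of a square matrix. -/
def numEigenvalues {ι : Type*} [Fintype ι] [DecidableEq ι] (M : Matrix ι ι ℂ) : ℕ :=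
  {μ : ℂ | Module.End.HasEigenvalue (Matrix.toEuclideanLin M) μ}.ncard

/-- The matrix of the orthogonal projection onto the eigenspace of `H` for `μ`. -/
def eigenProj {ι : Type*} [Fintype ι] [DecidableEq ι] (H : Matrix ι ι ℂ) (μ : ℂ) :
    Matrix ι ι ℂ :=
  Matrix.toEuclideanLin.symm
    (Module.End.eigenspace (Matrix.toEuclideanLin H) μ).starProjection.toLinearMap

/-- The pinching map with respect to the spectral decomposition of a Hermitian matrix `H`:
`X ↦ ∑ H_i X H_i`, summed over the distinct eigenvalues of `H`. -/
def pinch {ι : Type*} [Fintype ι] [DecidableEq ι] (H X : Matrix ι ι ℂ) : Matrix ι ι ℂ :=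
  ∑ μ : Module.End.Eigenvalues (Matrix.toEuclideanLin H), eigenProj H μ * X * eigenProj H μ

section

variable {U V X B : Type*} [Fintype U] [Fintype V] [Fintype X] [Fintype B] [DecidableEq B]

/-- `E^{B^n}`, the pinching map of `(ρ^B)^{⊗n}`. -/
def pinch₀ (ρB : Matrix B B ℂ) (n : ℕ) (Y : Matrix (Fin n → B) (Fin n → B) ℂ) :
    Matrix (Fin n → B) (Fin n → B) ℂ :=
  pinch (tensor fun _ : Fin n => ρB) Y

/-- `E_{1|u^n}^{B^n}`, the pinching map of `E^{B^n}(ρ_{u^n})`. -/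
def pinch₁ (ρB : Matrix B B ℂ) (ρU : U → Matrix B B ℂ) {n : ℕ} (u : Fin n → U)
    (Y : Matrix (Fin n → B) (Fin n → B) ℂ) : Matrix (Fin n → B) (Fin n → B) ℂ :=
  pinch (pinch₀ ρB n (tensor fun i => ρU (u i))) Y

/-- The number of distinct eigenvalues of `(ρ^B)^{⊗n}`. -/
def nu (ρB : Matrix B B ℂ) (n : ℕ) : ℕ :=
  numEigenvalues (tensor fun _ : Fin n => ρB)

/-- The maximum over `u^n` of the number of distinct eigenvalues of `E^{B^n}(ρ_{u^n})`. -/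
def nu₁ (ρB : Matrix B B ℂ) (ρU : U → Matrix B B ℂ) (n : ℕ) : ℕ :=
  Finset.univ.sup fun u : Fin n → U =>
    numEigenvalues (pinch₀ ρB n (tensor fun i => ρU (u i)))

/-- The maximum over `u^n, v^n` of the number of distinct eigenvalues of
`E_{1|u^n}^{B^n}(ρ_{v^n})`. -/
def nu₂ (ρB : Matrix B B ℂ) (ρU : U → Matrix B B ℂ) (ρV : V → Matrix B B ℂ) (n : ℕ) : ℕ :=
  Finset.univ.sup fun s : (Fin n → U) × (Fin n → V) =>
    numEigenvalues (pinch₁ ρB ρU s.1 (tensor fun i => ρV (s.2 i)))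

/-- The maximum over `u^n, v^n, x^n` of the number of distinct eigenvalues of
`E_{1|u^n}^{B^n}(ρ_{v^n,x^n})`. -/
def nu₃ (ρB : Matrix B B ℂ) (ρU : U → Matrix B B ℂ) (ρVX : V × X → Matrix B B ℂ) (n : ℕ) : ℕ :=
  Finset.univ.sup fun s : (Fin n → U) × (Fin n → V) × (Fin n → X) =>
    numEigenvalues (pinch₁ ρB ρU s.1 (tensor fun i => ρVX (s.2.1 i, s.2.2 i)))

end

end Pinching

end

noncomputable section

namespace Pinching

open Matrix

/-! ### Counting orbits of words -/

section Orbits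

variable {T P : Type*} {n : ℕ}

/-! Pinching preserves symmetry: each matrix whose eigenvalues define ν₁, ν₂, ν₃ is invariant under
all permutations of the positions fixing a labelling by `U`, `V × U` or `(X × V) × U`. For an
invariant `A`, each eigenvalue `μ` yields a nonzero invariant `F` with `F * A = μ • F`. Operators
acting on the rows commute with right multiplication by `A`, so `F` can be moved into `extremal c
r`, the analogue of highest weight vectors in Schur–Weyl duality
(`exists_mem_extremal_mul_eq_smul`). Distinct eigenvalues give independent `F`, so the dimension of
that space bounds their number. By `eq_zero_of_mem_extremal` its elements are determined by entries
at words of lower pairs; up to symmetry only the letter counts matter, whence the polynomial bound.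
For ν, the eigenvalues are products of those of `ρ^B` and depend only on letter counts. -/

/-- The number of positions at which the word `f` has the letter `p`, among those labelled `t`,
recorded for all letters `p` other than a reference letter `p₀`. -/
def profile [DecidableEq T] [DecidableEq P] (c : Fin n → T) (p₀ : P) (f : Fin n → P) :
    T × {p : P // p ≠ p₀} → Fin (n + 1) := fun q =>
  ⟨(Finset.univ.filter fun i => c i = q.1 ∧ f i = q.2).card, by
    have := Finset.card_filter_le (Finset.univ : Finset (Fin n)) (fun i => c i = q.1 ∧ f i = q.2)
    simp only [Finset.card_univ, Fintype.card_fin] at this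
    omega⟩

variable [Fintype P] [DecidableEq T] [DecidableEq P]

/-- Words with the same profile differ by a label-preserving permutation of the positions. -/
theorem exists_perm_of_profile_eq (c : Fin n → T) (p₀ : P) {f g : Fin n → P}
    (h : profile c p₀ f = profile c p₀ g) :
    ∃ σ : Equiv.Perm (Fin n), (∀ i, c (σ i) = c i) ∧ ∀ i, f (σ i) = g i := by
  have hne : ∀ t p, p ≠ p₀ → (Finset.univ.filter fun i => c i = t ∧ f i = p).card
      = (Finset.univ.filter fun i => c i = t ∧ g i = p).card := fun t p hp =>
    congrArg Fin.val (congrFun h (t, ⟨p, hp⟩))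
  have htot : ∀ (w : Fin n → P) t, (Finset.univ.filter fun i => c i = t).card
      = ∑ p, (Finset.univ.filter fun i => c i = t ∧ w i = p).card := by
    intro w t
    rw [Finset.card_eq_sum_card_fiberwise (f := w) (t := Finset.univ) (by simp)]
    simp only [Finset.filter_filter]
  have hall : ∀ t p, (Finset.univ.filter fun i => c i = t ∧ f i = p).card
      = (Finset.univ.filter fun i => c i = t ∧ g i = p).card := by
    intro t p
    by_cases hp : p = p₀
    · subst hp
      -- The reference letter's count is the size of the label class minus the other counts.
      have h1 := (htot f t).symm.trans (htot g t)
      rw [← Finset.add_sum_erase _ _ (Finset.mem_univ p),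
        ← Finset.add_sum_erase (a := p) Finset.univ
          (fun q => (Finset.univ.filter fun i => c i = t ∧ g i = q).card) (Finset.mem_univ p),
        Finset.sum_congr rfl fun q hq => hne t q (Finset.ne_of_mem_erase hq)] at h1
      exact Nat.add_right_cancel h1
    · exact hne t p hp
  have hfib : ∀ q : T × P, Nonempty ({i // (c i, g i) = q} ≃ {i // (c i, f i) = q}) := by
    rintro ⟨t, p⟩
    refine ⟨Fintype.equivOfCardEq ?_⟩
    rw [Fintype.card_subtype, Fintype.card_subtype]
    simpa only [Prod.mk.injEq] using (hall t p).symm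
  let e := fun q => (hfib q).some
  have he := fun i => Prod.mk.inj (Equiv.ofFiberEquiv_map e i)
  exact ⟨Equiv.ofFiberEquiv e, fun i => (he i).1, fun i => (he i).2⟩

theorem card_profile [Fintype T] (n : ℕ) (p₀ : P) :
    Fintype.card (T × {p : P // p ≠ p₀} → Fin (n + 1))
      = (n + 1) ^ (Fintype.card T * (Fintype.card P - 1)) := by
  simp [Fintype.card_subtype_compl]

end Orbits

/-! ### Invariant matrices and pinching -/

section Invariant

variable {T B : Type*} {n : ℕ}

/-- The action of a permutation of the positions on words. -/
def permWord (B : Type*) (σ : Equiv.Perm (Fin n)) : (Fin n → B) ≃ (Fin n → B) :=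
  σ.symm.arrowCongr (Equiv.refl B)

@[simp]
theorem permWord_apply (σ : Equiv.Perm (Fin n)) (a : Fin n → B) (i : Fin n) :
    permWord B σ a i = a (σ i) := rfl

/-- The matrix `F` on `B^n` is invariant under all permutations of the tensor factors which
preserve the labelling `c`. -/
def IsInvariant (c : Fin n → T) (F : Matrix (Fin n → B) (Fin n → B) ℂ) : Prop :=
  ∀ σ : Equiv.Perm (Fin n), (∀ i, c (σ i) = c i) →
    F.submatrix (permWord B σ) (permWord B σ) = F

theorem isInvariant_tensor (c : Fin n → T) (M : T → Matrix B B ℂ) :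
    IsInvariant c (tensor fun i => M (c i)) := by
  intro σ hσ
  ext a b
  simp only [tensor, submatrix_apply, of_apply, permWord_apply]
  rw [← Equiv.prod_comp σ fun i => M (c i) (a i) (b i)]
  simp only [hσ]

theorem IsInvariant.comp {T' : Type*} {c : Fin n → T} {F : Matrix (Fin n → B) (Fin n → B) ℂ}
    (g : T → T') (h : IsInvariant (fun i => g (c i)) F) : IsInvariant c F :=
  fun σ hσ => h σ fun i => congrArg g (hσ i)

theorem IsInvariant.mul [Fintype B] {c : Fin n → T} {F G : Matrix (Fin n → B) (Fin n → B) ℂ}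
    (hF : IsInvariant c F) (hG : IsInvariant c G) : IsInvariant c (F * G) := fun σ hσ => by
  rw [← submatrix_mul_equiv _ _ _ (permWord B σ) _, hF σ hσ, hG σ hσ]

/-- Every eigenvalue of an invariant matrix `A` is a left eigenvalue for an invariant matrix. -/
theorem exists_isInvariant_mul_eq_smul [Fintype B] [DecidableEq B] {c : Fin n → T} {A : Matrix (Fin n → B) (Fin n → B) ℂ}
    (hA : IsInvariant c A) {μ : ℂ} {v : (Fin n → B) → ℂ} (hv : v ≠ 0) (hAv : A *ᵥ v = μ • v) :
    ∃ F, IsInvariant c F ∧ F ≠ 0 ∧ F * A = μ • F := by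
  let S : Submodule ℂ (Matrix (Fin n → B) (Fin n → B) ℂ) :=
    { carrier := {F | IsInvariant c F}
      add_mem' := fun {F G} hF hG σ hσ => by
        rw [submatrix_add, Pi.add_apply, Pi.add_apply, hF σ hσ, hG σ hσ]
      zero_mem' := fun σ _ => rfl
      smul_mem' := fun z F hF σ hσ => by
        rw [submatrix_smul, Pi.smul_apply, Pi.smul_apply, hF σ hσ] }
  have hone : (1 : Matrix (Fin n → B) (Fin n → B) ℂ) ∈ S := fun σ _ =>
    submatrix_one_equiv (permWord B σ)
  have hsub : A - μ • 1 ∈ S := S.sub_mem hA (S.smul_mem μ hone)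
  let φ : S →ₗ[ℂ] S := (LinearMap.mulRight ℂ (A - μ • 1)).restrict
    fun F hF => IsInvariant.mul hF hsub
  have hφ : ∀ F : S, (φ F : Matrix (Fin n → B) (Fin n → B) ℂ) = F * (A - μ • 1) := fun F => rfl
  -- In finite dimension injectivity would give `A - μ • 1` a left inverse, impossible since it
  -- kills `v`.
  have hninj : ¬ Function.Injective φ := by
    intro hinj
    obtain ⟨F, hF⟩ := LinearMap.injective_iff_surjective.mp hinj ⟨1, hone⟩
    have h1 : (F : Matrix (Fin n → B) (Fin n → B) ℂ) * (A - μ • 1) = 1 := by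
      rw [← hφ, hF]
    apply hv
    rw [← one_mulVec v, ← h1, ← mulVec_mulVec, sub_mulVec, hAv, smul_mulVec, one_mulVec, sub_self,
      mulVec_zero]
  rw [← LinearMap.ker_eq_bot, Submodule.eq_bot_iff] at hninj
  push Not at hninj
  obtain ⟨F, hF, hF0⟩ := hninj
  refine ⟨F, F.2, fun h => hF0 (Subtype.ext h), ?_⟩
  have h0 := hφ F
  rw [LinearMap.mem_ker.mp hF, mul_sub, Matrix.mul_smul, mul_one] at h0
  exact (sub_eq_zero.mp h0.symm)

variable {ι : Type*} [Fintype ι] [DecidableEq ι]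

theorem eigenProj_apply (H : Matrix ι ι ℂ) (μ : ℂ) (i j : ι) :
    eigenProj H μ i j = (Module.End.eigenspace (Matrix.toEuclideanLin H) μ).starProjection
      (EuclideanSpace.single j 1) i := by
  set p := (Module.End.eigenspace (Matrix.toEuclideanLin H) μ).starProjection with hp
  have h : Matrix.toEuclideanLin (eigenProj H μ) = p.toLinearMap :=
    LinearEquiv.apply_symm_apply _ _
  have h2 := congrArg (fun L => L (EuclideanSpace.single j 1) i) h
  simpa [Matrix.toLpLin_apply] using! h2

/-- Permuting coordinates by `e` is a unitary commuting with `H`; it maps each eigenspace to itself,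
hence commutes with the orthogonal projection. -/
theorem eigenProj_submatrix {H : Matrix ι ι ℂ} {e : ι ≃ ι} (hH : H.submatrix e e = H) (μ : ℂ) :
    (eigenProj H μ).submatrix e e = eigenProj H μ := by
  set E := Module.End.eigenspace (Matrix.toEuclideanLin H) μ with hE
  let f : EuclideanSpace ℂ ι ≃ₗᵢ[ℂ] EuclideanSpace ℂ ι := LinearIsometryEquiv.piLpCongrLeft 2 ℂ ℂ e
  have hf : ∀ x i, f x i = x (e.symm i) := fun x i => rfl
  have hfs : ∀ x i, f.symm x i = x (e i) := fun x i => by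
    rw [← Equiv.symm_apply_apply e i, ← hf, f.apply_symm_apply, Equiv.symm_apply_apply]
  have hcomm : ∀ x, Matrix.toEuclideanLin H (f.symm x) = f.symm (Matrix.toEuclideanLin H x) := by
    intro x
    ext i
    rw [hfs, toLpLin_apply, toLpLin_apply]
    simp only [mulVec, dotProduct, hfs]
    conv_lhs => rw [← hH]
    exact Equiv.sum_comp e fun j => H (e i) j * x j
  have hmap : E.map (f.toLinearEquiv : EuclideanSpace ℂ ι →ₗ[ℂ] EuclideanSpace ℂ ι) = E := by
    ext x
    rw [Submodule.mem_map_equiv, hE, Module.End.mem_eigenspace_iff, Module.End.mem_eigenspace_iff]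
    change Matrix.toEuclideanLin H (f.symm x) = μ • f.symm x ↔ _
    rw [hcomm, ← map_smul, f.symm.injective.eq_iff]
  have hproj : ∀ x, E.starProjection x = f (E.starProjection (f.symm x)) := by
    intro x
    rw [← Submodule.starProjection_map_apply]
    simp only [hmap]
  ext i j
  have hsingle : f.symm (EuclideanSpace.single (e j) 1) = EuclideanSpace.single j 1 := by
    ext k
    simp [hfs]
  rw [submatrix_apply, eigenProj_apply, eigenProj_apply, ← hE, hproj, hf, Equiv.symm_apply_apply,
    hsingle]

theorem pinch_submatrix {H Y : Matrix ι ι ℂ} {e : ι ≃ ι} (hH : H.submatrix e e = H)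
    (hY : Y.submatrix e e = Y) : (pinch H Y).submatrix e e = pinch H Y := by
  have hsum : (pinch H Y).submatrix e e
      = ∑ μ : Module.End.Eigenvalues (Matrix.toEuclideanLin H),
        (eigenProj H μ * Y * eigenProj H μ).submatrix e e := by
    ext i j
    simp [pinch, Matrix.sum_apply]
  rw [hsum, pinch]
  refine Finset.sum_congr rfl fun μ _ => ?_
  rw [← submatrix_mul_equiv _ _ e e e, ← submatrix_mul_equiv _ _ e e e, eigenProj_submatrix hH, hY]

theorem IsInvariant.pinch [Fintype B] [DecidableEq B] {c : Fin n → T}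
    {H Y : Matrix (Fin n → B) (Fin n → B) ℂ} (hH : IsInvariant c H) (hY : IsInvariant c Y) :
    IsInvariant c (pinch H Y) :=
  fun σ hσ => pinch_submatrix (hH σ hσ) (hY σ hσ)

end Invariant

/-! ### Invariant matrices annihilated by the lowering operators -/

section Extremal

variable {B : Type*} {n : ℕ}

/-- The pairs of letters `(k, l)` with `l` not above `k`. -/
abbrev LowerPair (r : B → ℕ) : Type _ := {p : B × B // r p.2 ≤ r p.1}

/-- The exponent for one label: `d(d+1)/2` lower pairs, less the reference pair. -/
theorem card_lowerPair_equivFin [Fintype B] :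
    Fintype.card (LowerPair fun b : B => (Fintype.equivFin B b : ℕ)) - 1
      = (Fintype.card B + 2) * (Fintype.card B - 1) / 2 := by
  have h1 : Fintype.card (LowerPair fun b : B => (Fintype.equivFin B b : ℕ))
      = ∑ k ∈ Finset.range (Fintype.card B), (k + 1) := by
    rw [Fintype.card_congr (Equiv.subtypeProdEquivSigmaSubtype fun k l : B =>
      (Fintype.equivFin B l : ℕ) ≤ Fintype.equivFin B k), Fintype.card_sigma, Finset.sum_range,
      ← Equiv.sum_comp (Fintype.equivFin B)]
    refine Finset.sum_congr rfl fun k _ => ?_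
    have hk : {l // (Fintype.equivFin B l : ℕ) ≤ Fintype.equivFin B k}
        ≃ {m // m ≤ Fintype.equivFin B k} :=
      (Fintype.equivFin B).subtypeEquiv fun _ => Iff.rfl
    rw [Fintype.card_congr hk, Fintype.card_subtype]
    have : (Finset.univ.filter fun m => m ≤ Fintype.equivFin B k)
        = Finset.Iic (Fintype.equivFin B k) := by ext; simp
    rw [this, Fin.card_Iic]
  have h2 : ∀ d, (∑ k ∈ Finset.range d, (k + 1)) * 2 = (d + 1) * d := by
    intro d
    have h := Finset.sum_range_id_mul_two (d + 1)
    rwa [Finset.sum_range_succ', add_zero, Nat.add_sub_cancel] at h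
  rw [h1]
  generalize Fintype.card B = d
  have h2 := h2 d
  rcases d with _ | d
  · simp
  · have h3 : (d + 1 + 2) * (d + 1 - 1) + 2 = (d + 1 + 1) * (d + 1) := by
      rw [Nat.add_sub_cancel]; ring
    omega

/-- The total weight of the positions violating `r (b i) ≤ r (a i)`. -/
def excess (r : B → ℕ) (a b : Fin n → B) : ℕ :=
  ∑ i, if r (a i) < r (b i) then r (b i) else 0

/-- Repairing `i` may break `j`. Weighting violations by `r (b i)` rather than counting them makes
this a net loss. -/
theorem excess_lt_excess {r : B → ℕ} {a a' b : Fin n → B} {i j : Fin n} (hij : i ≠ j)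
    (ha : ∀ m, m ≠ i → m ≠ j → a' m = a m) (hi : r (a i) < r (b i)) (hi' : r (b i) ≤ r (a' i))
    (hj : r (b j) ≤ r (a j)) (hj' : r (b j) < r (b i)) : excess r a' b < excess r a b := by
  have hmem : j ∈ (Finset.univ : Finset (Fin n)).erase i := by simp [hij.symm]
  unfold excess
  rw [← Finset.add_sum_erase _ _ (Finset.mem_univ i), ← Finset.add_sum_erase _ _ hmem,
    ← Finset.add_sum_erase (a := i) Finset.univ
      (fun m => if r (a m) < r (b m) then r (b m) else 0) (Finset.mem_univ i),
    ← Finset.add_sum_erase (a := j) _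
      (fun m => if r (a m) < r (b m) then r (b m) else 0) hmem,
    if_neg hi'.not_gt, if_pos hi, if_neg hj.not_gt,
    Finset.sum_congr rfl fun m hm => by
      rw [ha m (Finset.ne_of_mem_erase (Finset.mem_of_mem_erase hm)) (Finset.ne_of_mem_erase hm)]]
  split_ifs <;> omega

variable {T : Type*} [DecidableEq T] [DecidableEq B]

/-- Left multiplication by the sum over all positions labelled `t` of the matrix units
`|l⟩⟨k|`. -/
def replaceLetter (c : Fin n → T) (t : T) (k l : B) :
    Matrix (Fin n → B) (Fin n → B) ℂ →ₗ[ℂ] Matrix (Fin n → B) (Fin n → B) ℂ where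
  toFun F := Matrix.of fun a b =>
    ∑ i with c i = t ∧ a i = l, F (Function.update a i k) b
  map_add' F G := by ext a b; simp [Finset.sum_add_distrib]
  map_smul' z F := by ext a b; simp [Finset.mul_sum]

theorem replaceLetter_apply (c : Fin n → T) (t : T) (k l : B)
    (F : Matrix (Fin n → B) (Fin n → B) ℂ) (a b : Fin n → B) :
    replaceLetter c t k l F a b = ∑ i with c i = t ∧ a i = l, F (Function.update a i k) b := rfl

/-- Consequently these operators preserve the relation `F * A = μ • F`. -/
theorem replaceLetter_mul [Fintype B] (c : Fin n → T) (t : T) (k l : B)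
    (F A : Matrix (Fin n → B) (Fin n → B) ℂ) :
    replaceLetter c t k l (F * A) = replaceLetter c t k l F * A := by
  ext a b
  simp only [replaceLetter_apply, mul_apply, Finset.sum_mul]
  exact Finset.sum_comm

theorem IsInvariant.replaceLetter {c : Fin n → T} {F : Matrix (Fin n → B) (Fin n → B) ℂ}
    (hF : IsInvariant c F) (t : T) (k l : B) : IsInvariant c (replaceLetter c t k l F) := by
  intro σ hσ
  ext a b
  rw [submatrix_apply, replaceLetter_apply, replaceLetter_apply, Finset.sum_filter,
    Finset.sum_filter,
    ← Equiv.sum_comp σ fun i => if c i = t ∧ a i = l then F (Function.update a i k) b else 0]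
  refine Finset.sum_congr rfl fun i _ => ?_
  have hu : Function.update (permWord B σ a) i k = permWord B σ (Function.update a (σ i) k) := by
    have := Function.update_comp_equiv a σ (σ i) k
    rw [Equiv.symm_apply_apply] at this
    exact this.symm
  refine if_congr (by rw [hσ, permWord_apply]) ?_ rfl
  rw [hu]
  exact congrFun (congrFun (hF σ hσ) (Function.update a (σ i) k)) b

/-- The invariant matrices annihilated by all operators replacing a letter by a smaller one,
where the order of the letters is given by `r`. -/
def extremal (c : Fin n → T) (r : B → ℕ) : Submodule ℂ (Matrix (Fin n → B) (Fin n → B) ℂ) where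
  carrier := {F | IsInvariant c F ∧ ∀ t k l, r k < r l → replaceLetter c t k l F = 0}
  add_mem' {F G} hF hG := ⟨fun σ hσ => by
      rw [submatrix_add, Pi.add_apply, Pi.add_apply, hF.1 σ hσ, hG.1 σ hσ],
    fun t k l h => by rw [map_add, hF.2 t k l h, hG.2 t k l h, add_zero]⟩
  zero_mem' := ⟨fun σ _ => rfl, fun t k l _ => map_zero _⟩
  smul_mem' z F hF := ⟨fun σ hσ => by
      rw [submatrix_smul, Pi.smul_apply, Pi.smul_apply, hF.1 σ hσ],
    fun t k l h => by rw [map_smul, hF.2 t k l h, smul_zero]⟩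

/-- A matrix in `extremal c r` is determined by its entries `F a b` with `r (b i) ≤ r (a i)` for
all `i`. -/
theorem eq_zero_of_mem_extremal {c : Fin n → T} {r : B → ℕ} (hr : Function.Injective r)
    {F : Matrix (Fin n → B) (Fin n → B) ℂ} (hF : F ∈ extremal c r)
    (h : ∀ a b, (∀ i, r (b i) ≤ r (a i)) → F a b = 0) : F = 0 := by
  suffices H : ∀ (w : ℕ) (a b : Fin n → B), excess r a b = w → F a b = 0 by
    ext a b
    exact H _ a b rfl
  intro w
  induction w using Nat.strong_induction_on with
  | _ w ih =>
  intro a b hw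
  by_cases hab : ∀ i, r (b i) ≤ r (a i)
  · exact h a b hab
  push Not at hab
  -- Maximality of `r (b i)` ensures that any position newly broken below has smaller weight.
  obtain ⟨i, hi, hmax⟩ := Finset.exists_max_image
    (Finset.univ.filter fun i => r (a i) < r (b i)) (fun i => r (b i))
    (by obtain ⟨i, hi⟩ := hab; exact ⟨i, by simpa using hi⟩)
  simp only [Finset.mem_filter, Finset.mem_univ, true_and] at hi hmax
  -- The vanishing relation is read at the row with position `i` repaired. Terms with `b j = b i`
  -- are `F a b` by swapping `i` and `j`; the others have smaller excess and vanish by induction.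
  have hrel := congrFun (congrFun (hF.2 (c i) (a i) (b i) hi) (Function.update a i (b i))) b
  rw [replaceLetter_apply] at hrel
  have hterm : ∀ j ∈ Finset.univ.filter
      (fun j => c j = c i ∧ Function.update a i (b i) j = b i),
      F (Function.update (Function.update a i (b i)) j (a i)) b
        = if b j = b i then F a b else 0 := by
    intro j hj
    simp only [Finset.mem_filter, Finset.mem_univ, true_and] at hj
    obtain ⟨hcj, haj⟩ := hj
    split_ifs with hbj
    · have hσ : ∀ m, c (Equiv.swap i j m) = c m := by
        intro m
        rcases eq_or_ne m i with rfl | hmi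
        · rw [Equiv.swap_apply_left, hcj]
        rcases eq_or_ne m j with rfl | hmj
        · rw [Equiv.swap_apply_right, hcj]
        · rw [Equiv.swap_apply_of_ne_of_ne hmi hmj]
      have h1 := congrFun (congrFun (hF.1 (Equiv.swap i j) hσ) a) b
      rw [submatrix_apply] at h1
      rw [← h1]
      congr 1
      · ext m
        simp only [permWord_apply]
        rcases eq_or_ne m j with rfl | hmj
        · rw [Equiv.swap_apply_right, Function.update_self]
        rw [Function.update_of_ne hmj]
        rcases eq_or_ne m i with rfl | hmi
        · rw [Equiv.swap_apply_left, Function.update_self, ← haj, Function.update_of_ne hmj.symm]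
        · rw [Equiv.swap_apply_of_ne_of_ne hmi hmj, Function.update_of_ne hmi]
      · ext m
        simp only [permWord_apply]
        rcases eq_or_ne m i with rfl | hmi
        · rw [Equiv.swap_apply_left, hbj]
        rcases eq_or_ne m j with rfl | hmj
        · rw [Equiv.swap_apply_right, hbj]
        · rw [Equiv.swap_apply_of_ne_of_ne hmi hmj]
    · have hij : i ≠ j := fun hij => hbj (by rw [hij])
      rw [Function.update_of_ne hij.symm] at haj
      have hle : r (b j) ≤ r (b i) := by
        by_contra hlt
        exact hlt (hmax j (by rw [haj]; omega))
      have hlt : r (b j) < r (b i) := lt_of_le_of_ne hle fun e => hbj (hr e)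
      refine ih _ ?_ _ b rfl
      rw [← hw]
      refine excess_lt_excess hij (fun m hmi hmj => ?_) hi ?_ (by rw [haj]; exact hle) hlt
      · rw [Function.update_of_ne hmj, Function.update_of_ne hmi]
      · rw [Function.update_of_ne hij, Function.update_self]
  rw [Finset.sum_congr rfl hterm, ← Finset.sum_filter, Finset.sum_const, Matrix.zero_apply,
    nsmul_eq_mul, mul_eq_zero] at hrel
  refine hrel.resolve_left ?_
  refine Nat.cast_ne_zero.mpr ?_
  -- The term `j = i` makes the multiplicity of `F a b` nonzero.
  exact Finset.card_ne_zero_of_mem (a := i) (by simp)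

variable [Fintype B]

/-- Every eigenvalue of an invariant matrix `A` is an eigenvalue of the right multiplication by
`A` on `extremal c r`. -/
theorem exists_mem_extremal_mul_eq_smul {c : Fin n → T} (r : B → ℕ)
    {A : Matrix (Fin n → B) (Fin n → B) ℂ} (hA : IsInvariant c A) {μ : ℂ}
    {v : (Fin n → B) → ℂ} (hv : v ≠ 0) (hAv : A *ᵥ v = μ • v) :
    ∃ F ∈ extremal c r, F ≠ 0 ∧ F * A = μ • F := by
  by_contra hcon
  push Not at hcon
  -- Each nonzero application of an operator raises the least possible row weight in the support by
  -- at least one, so the process must stop.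
  have step : ∀ s : ℕ, ∃ F, IsInvariant c F ∧ F ≠ 0 ∧ F * A = μ • F ∧
      ∀ a b, ∑ i, r (a i) < s → F a b = 0 := by
    intro s
    induction s with
    | zero =>
      obtain ⟨F, h1, h2, h3⟩ := exists_isInvariant_mul_eq_smul hA hv hAv
      exact ⟨F, h1, h2, h3, fun a b h => absurd h (Nat.not_lt_zero _)⟩
    | succ s ih =>
      obtain ⟨F, hF, hF0, hFA, hs⟩ := ih
      have hnot : ¬ ∀ t k l, r k < r l → replaceLetter c t k l F = 0 := fun h =>
        hcon F ⟨hF, h⟩ hF0 hFA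
      push Not at hnot
      obtain ⟨t, k, l, hkl, hne⟩ := hnot
      refine ⟨_, hF.replaceLetter t k l, hne, by rw [← replaceLetter_mul, hFA, map_smul], ?_⟩
      intro a b hab
      rw [replaceLetter_apply]
      refine Finset.sum_eq_zero fun i hi => hs _ _ ?_
      simp only [Finset.mem_filter, Finset.mem_univ, true_and] at hi
      have hlt : ∑ j, r (Function.update a i k j) < ∑ j, r (a j) := by
        refine Finset.sum_lt_sum (fun j _ => ?_) ⟨i, Finset.mem_univ i, ?_⟩
        · rcases eq_or_ne j i with rfl | hj
          · rw [Function.update_self, hi.2]; exact hkl.le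
          · rw [Function.update_of_ne hj]
        · rw [Function.update_self, hi.2]; exact hkl
      omega
  -- The sum of the weights of all words, plus one, exceeds every single weight.
  obtain ⟨F, -, hF0, -, hs⟩ := step (∑ a : Fin n → B, ∑ i, r (a i) + 1)
  refine hF0 (Matrix.ext fun a b => hs a b ?_)
  have := Finset.single_le_sum (f := fun a : Fin n → B => ∑ i, r (a i))
    (fun _ _ => Nat.zero_le _) (Finset.mem_univ a)
  exact Nat.lt_succ_of_le this

/-- Evaluation at one word of lower pairs per profile is injective: invariance makes entries agree
along an orbit. -/
theorem finrank_extremal_le [Fintype T] (c : Fin n → T) {r : B → ℕ} (hr : Function.Injective r)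
    [Nonempty B] : Module.finrank ℂ (extremal c r)
      ≤ (n + 1) ^ (Fintype.card T * (Fintype.card (LowerPair r) - 1)) := by
  classical
  let b₀ : B := Classical.arbitrary B
  let p₀ : LowerPair r := ⟨(b₀, b₀), le_rfl⟩
  -- Profiles realised by no word get a junk constant word, which only adds harmless coordinates.
  let w : (T × {p : LowerPair r // p ≠ p₀} → Fin (n + 1)) → Fin n → LowerPair r := fun m =>
    if h : ∃ f, profile c p₀ f = m then h.choose else fun _ => p₀
  have hw : ∀ f, profile c p₀ (w (profile c p₀ f)) = profile c p₀ f := by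
    intro f
    have h : ∃ g, profile c p₀ g = profile c p₀ f := ⟨f, rfl⟩
    simp only [w, dif_pos h]
    exact h.choose_spec
  let ψ : Matrix (Fin n → B) (Fin n → B) ℂ →ₗ[ℂ]
      ((T × {p : LowerPair r // p ≠ p₀} → Fin (n + 1)) → ℂ) :=
    { toFun := fun F m => F (fun i => (w m i).1.1) (fun i => (w m i).1.2)
      map_add' := fun _ _ => rfl
      map_smul' := fun _ _ => rfl }
  have hinj : Function.Injective (ψ.comp (extremal c r).subtype) := by
    rw [← LinearMap.ker_eq_bot, Submodule.eq_bot_iff]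
    rintro ⟨F, hF⟩ h0
    refine Subtype.ext (eq_zero_of_mem_extremal hr hF fun a b hab => ?_)
    let f : Fin n → LowerPair r := fun i => ⟨(a i, b i), hab i⟩
    obtain ⟨σ, hσ, hf⟩ := exists_perm_of_profile_eq c p₀ (hw f)
    have h1 : F (fun i => (w (profile c p₀ f) i).1.1) (fun i => (w (profile c p₀ f) i).1.2) = 0 :=
      congrFun (LinearMap.mem_ker.mp h0) (profile c p₀ f)
    rw [← hF.1 σ hσ, submatrix_apply] at h1
    convert h1 using 2
    · ext i
      rw [permWord_apply, hf i]
    · ext i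
      rw [permWord_apply, hf i]
  have := LinearMap.finrank_le_finrank_of_injective hinj
  rwa [Module.finrank_fintype_fun_eq_card, card_profile] at this

theorem numEigenvalues_le_finrank_extremal {c : Fin n → T} (r : B → ℕ)
    {A : Matrix (Fin n → B) (Fin n → B) ℂ} (hA : IsInvariant c A) :
    numEigenvalues A ≤ Module.finrank ℂ (extremal c r) := by
  have hex : ∀ μ : {μ : ℂ | Module.End.HasEigenvalue (Matrix.toEuclideanLin A) μ},
      ∃ F ∈ extremal c r, F ≠ 0 ∧ F * A = (μ : ℂ) • F := by
    rintro ⟨μ, hμ⟩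
    obtain ⟨v, hv⟩ := Module.End.HasEigenvalue.exists_hasEigenvector hμ
    refine exists_mem_extremal_mul_eq_smul r hA (v := WithLp.ofLp v) (fun h => hv.2 ?_) ?_
    · exact (WithLp.ofLp_eq_zero 2).mp h
    · exact congrArg WithLp.ofLp hv.apply_eq_smul
  choose G hGmem hG0 hGA using hex
  have hli : LinearIndependent ℂ G :=
    Module.End.eigenvectors_linearIndependent' (LinearMap.mulRight ℂ A) _ Subtype.val_injective G
      fun μ => ⟨Module.End.mem_eigenspace_iff.mpr (hGA μ), hG0 μ⟩
  have hli' : LinearIndependent ℂ fun μ => (⟨G μ, hGmem μ⟩ : extremal c r) :=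
    LinearIndependent.of_comp (extremal c r).subtype hli
  have hfin := hli'.finite
  have := Fintype.ofFinite {μ : ℂ | Module.End.HasEigenvalue (Matrix.toEuclideanLin A) μ}
  rw [numEigenvalues, ← Nat.card_coe_set_eq, Nat.card_eq_fintype_card]
  exact hli'.fintype_card_le_finrank

/-- An invariant matrix has at most polynomially many eigenvalues. -/
theorem IsInvariant.numEigenvalues_le [Fintype T] [Nonempty B] {c : Fin n → T}
    {A : Matrix (Fin n → B) (Fin n → B) ℂ} (hA : IsInvariant c A) :
    numEigenvalues A
      ≤ (n + 1) ^ (Fintype.card T * (Fintype.card B + 2) * (Fintype.card B - 1) / 2) := by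
  have hr : Function.Injective fun b : B => (Fintype.equivFin B b : ℕ) :=
    Fin.val_injective.comp (Fintype.equivFin B).injective
  refine (numEigenvalues_le_finrank_extremal _ hA).trans ((finrank_extremal_le c hr).trans ?_)
  rw [card_lowerPair_equivFin, mul_assoc]
  -- The number of labels is moved inside the floor division.
  exact Nat.pow_le_pow_right n.succ_pos (Nat.mul_div_le_mul_div_assoc _ _ _)

end Extremal

/-! ### Tensor powers of a Hermitian matrix -/

section TensorPower

variable {B : Type*} {n : ℕ}

theorem tensor_mul [Fintype B] (M N : Fin n → Matrix B B ℂ) :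
    tensor (fun i => M i * N i) = tensor M * tensor N := by
  classical
  ext a b
  simp only [tensor, of_apply, mul_apply, Fintype.prod_sum, ← Finset.prod_mul_distrib]

theorem tensor_diagonal [DecidableEq B] (D : Fin n → B → ℂ) :
    tensor (fun i => diagonal (D i)) = diagonal fun a : Fin n → B => ∏ i, D i (a i) := by
  ext a b
  by_cases h : a = b
  · subst h
    simp [tensor]
  · rw [diagonal_apply_ne _ h]
    obtain ⟨i, hi⟩ := Function.ne_iff.mp h
    exact Finset.prod_eq_zero (Finset.mem_univ i) (diagonal_apply_ne _ hi)

/-- Diagonalising `M` diagonalises its tensor power; a product of eigenvalues along a word depends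
only on the word's profile. -/
theorem numEigenvalues_tensor_le [Fintype B] [DecidableEq B] [Nonempty B] {M : Matrix B B ℂ} (hM : M.IsHermitian) (n : ℕ) :
    numEigenvalues (tensor fun _ : Fin n => M) ≤ (n + 1) ^ (Fintype.card B - 1) := by
  classical
  let D : B → ℂ := RCLike.ofReal ∘ hM.eigenvalues
  let W : Matrix B B ℂ := hM.eigenvectorUnitary
  have hW : star W * W = 1 := Unitary.coe_star_mul_self hM.eigenvectorUnitary
  have hW' : W * star W = 1 := Unitary.coe_mul_star_self hM.eigenvectorUnitary
  have hspec : star W * M = diagonal D * star W := by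
    have h : M = W * diagonal D * star W := by
      conv_lhs => rw [hM.spectral_theorem]
      rw [Unitary.conjStarAlgAut_apply]
    rw [h, ← mul_assoc, ← mul_assoc, hW, one_mul]
  have hone : tensor (fun _ : Fin n => (1 : Matrix B B ℂ)) = 1 := by
    have := tensor_diagonal (n := n) fun _ (_ : B) => (1 : ℂ)
    simpa using this
  have hsub : {μ : ℂ | Module.End.HasEigenvalue
      (Matrix.toEuclideanLin (tensor fun _ : Fin n => M)) μ}
      ⊆ Set.range fun a : Fin n → B => ∏ i, D (a i) := by
    intro μ hμ
    obtain ⟨v, hv⟩ := Module.End.HasEigenvalue.exists_hasEigenvector hμ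
    have hMv : tensor (fun _ : Fin n => M) *ᵥ WithLp.ofLp v = μ • WithLp.ofLp v :=
      congrArg WithLp.ofLp hv.apply_eq_smul
    set x := tensor (fun _ : Fin n => star W) *ᵥ WithLp.ofLp v with hx
    have hx0 : x ≠ 0 := by
      intro h
      refine hv.2 ((WithLp.ofLp_eq_zero 2).mp ?_)
      rw [← one_mulVec (WithLp.ofLp v), ← hone, ← hW', tensor_mul, ← mulVec_mulVec, ← hx, h,
        mulVec_zero]
    have hDx : diagonal (fun a : Fin n → B => ∏ i, D (a i)) *ᵥ x = μ • x := by
      rw [← tensor_diagonal fun _ => D, hx, mulVec_mulVec, ← tensor_mul, ← hspec, tensor_mul,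
        ← mulVec_mulVec, hMv, mulVec_smul]
    obtain ⟨a, ha⟩ := Function.ne_iff.mp hx0
    have := congrFun hDx a
    rw [mulVec_diagonal, Pi.smul_apply, smul_eq_mul] at this
    exact ⟨a, mul_right_cancel₀ ha this⟩
  let p₀ : B := Classical.arbitrary B
  have hfac : Set.range (fun a : Fin n → B => ∏ i, D (a i)) ⊆
      (fun m => ∏ i, D (Function.invFun (profile (fun _ : Fin n => ()) p₀) m i)) ''
        (Set.univ : Set (Unit × {p : B // p ≠ p₀} → Fin (n + 1))) := by
    rintro _ ⟨a, rfl⟩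
    refine ⟨profile (fun _ => ()) p₀ a, Set.mem_univ _, ?_⟩
    obtain ⟨σ, -, hσ⟩ := exists_perm_of_profile_eq (fun _ : Fin n => ()) p₀
      (Function.invFun_eq (f := profile (fun _ : Fin n => ()) p₀) ⟨a, rfl⟩)
    simp only [← hσ]
    exact (Equiv.prod_comp σ fun i => D (Function.invFun (profile (fun _ : Fin n => ()) p₀)
      (profile (fun _ => ()) p₀ a) i)).symm
  calc numEigenvalues (tensor fun _ : Fin n => M)
      ≤ (Set.univ : Set (Unit × {p : B // p ≠ p₀} → Fin (n + 1))).ncard :=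
        (Set.ncard_le_ncard (hsub.trans hfac) (Set.toFinite _)).trans
          (Set.ncard_image_le (Set.toFinite _))
    _ = (n + 1) ^ (Fintype.card B - 1) := by
        rw [Set.ncard_univ, Nat.card_eq_fintype_card, card_profile, Fintype.card_unit, one_mul]

end TensorPower

open scoped ComplexOrder in
theorem IsCQState.isHermitian_reducedState {Z B : Type*} [Fintype Z] [Fintype B]
    {ρ : Matrix (Z × B) (Z × B) ℂ} (hρ : IsCQState ρ) : (reducedState ρ).IsHermitian := by
  refine IsHermitian.ext fun a b => ?_
  simp only [reducedState, of_apply, star_sum]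
  exact Finset.sum_congr rfl fun z _ => hρ.isDensity.posSemidef.isHermitian.apply _ _

theorem IsCQState.nonempty {Z B : Type*} [Fintype Z] [Fintype B]
    {ρ : Matrix (Z × B) (Z × B) ℂ} (hρ : IsCQState ρ) : Nonempty B := by
  by_contra h
  rw [not_nonempty_iff] at h
  have := hρ.isDensity.trace_eq_one
  simp [Matrix.trace] at this

end Pinching

end

open Pinching in
theorem proposition1 {U V X B : Type*} [Fintype U] [Fintype V] [Fintype X] [Fintype B]
    [DecidableEq U] [DecidableEq V] [DecidableEq X] [DecidableEq B]
    (ρ : Matrix ((U × V × X) × B) ((U × V × X) × B) ℂ) (hρ : Pinching.IsCQState ρ)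
    (ρU : U → Matrix B B ℂ) (hU : Pinching.IsConditionalState (fun z : U × V × X => z.1) ρ ρU)
    (ρV : V → Matrix B B ℂ) (hV : Pinching.IsConditionalState (fun z : U × V × X => z.2.1) ρ ρV)
    (ρVX : V × X → Matrix B B ℂ)
    (hVX : Pinching.IsConditionalState (fun z : U × V × X => z.2) ρ ρVX)
    (n : ℕ) :
    Pinching.nu (Pinching.reducedState ρ) n ≤ (n + 1) ^ (Fintype.card B - 1) ∧
    Pinching.nu₁ (Pinching.reducedState ρ) ρU n ≤
      (n + 1) ^ (Fintype.card U * (Fintype.card B + 2) * (Fintype.card B - 1) / 2) ∧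
    Pinching.nu₂ (Pinching.reducedState ρ) ρU ρV n ≤
      (n + 1) ^ (Fintype.card V * Fintype.card U *
        (Fintype.card B + 2) * (Fintype.card B - 1) / 2) ∧
    Pinching.nu₃ (Pinching.reducedState ρ) ρU ρVX n ≤
      (n + 1) ^ (Fintype.card X * Fintype.card V * Fintype.card U *
        (Fintype.card B + 2) * (Fintype.card B - 1) / 2) := by
  have := hρ.nonempty
  have h₀ (u : Fin n → U) :
      IsInvariant u (pinch₀ (reducedState ρ) n (tensor fun i => ρU (u i))) :=
    (isInvariant_tensor u fun _ => reducedState ρ).pinch (isInvariant_tensor u ρU)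
  refine ⟨numEigenvalues_tensor_le hρ.isHermitian_reducedState n,
    Finset.sup_le fun u _ => (h₀ u).numEigenvalues_le, Finset.sup_le fun s _ => ?_,
    Finset.sup_le fun s _ => ?_⟩
  · rw [← Fintype.card_prod]
    -- The joint labelling refines both sequences, so the pinching matrix and the pinched state are
    -- both invariant for it.
    let c : Fin n → V × U := fun i => (s.2 i, s.1 i)
    exact (((h₀ s.1).comp (c := c) Prod.snd).pinch
      (isInvariant_tensor c fun t => ρV t.1)).numEigenvalues_le
  · rw [← Fintype.card_prod, ← Fintype.card_prod]
    let c : Fin n → (X × V) × U := fun i => ((s.2.2 i, s.2.1 i), s.1 i)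
    exact (((h₀ s.1).comp (c := c) Prod.snd).pinch
      (isInvariant_tensor c fun t => ρVX (t.1.2, t.1.1))).numEigenvalues_le
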